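/- Consider the synchronous sleeping model on a clique of $n$ processors with distinct identifiers $1,\dots,n$. In each round every awake processor sends at most one message on each of its links, then receives the messages sent to it in this round (knowing on which link each arrives), and then computes locally; at the end of the round it either returns an output value and stops, or chooses a number $r\ge 0$ of following rounds during which it sleeps. A sleeping processor neither sends nor receives, and messages sent to it are lost. All processors are awake in the first round. No signature infrastructure is available (the algorithm is unauthenticated). An adaptive, omniscient adversary may make up to $f$ processors Byzantine, each at any time; from then on it controls completely which messages that processor sends. A processor is honest if it is never corrupted. There are an absolute constant $C$ and deterministic unauthenticated algorithms $A_{V,n,f}$, one for each value set $V$ and all integers $n,f\ge 0$, such that whenever $f<n/3$, the algorithm $A_{V,n,f}$ solves Byzantine agreement for $n$ processors with inputs in $V$ in the presence of up to $f$ Byzantine processors, that is, in every execution * (safety) if an honest processor outputs $v$, then every honest processor outputs $v$; * (validity) if all honest processors have the same input $v$, then every honest processor outputs $v$; * (termination) every honest processor outputs a value after finitely many rounds; and moreover * its awake complexity, the maximum over all such executions and all processors of the number of rounds that the processor spends awake (before it is corrupted, if ever), is at most $C\,(1+\lfloor\log_2(f+1)\rfloor)$, hence $O(\log f)$; * its round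 complexity, the maximum over all such executions and all processors of the number of rounds until the processor terminates (or is corrupted, if that is earlier), is at most $C\,(f+1)$, hence $O(f)$. -/

import Mathlib

universe u

namespace SleepingModel

/-- What a processor does at the end of a round in which it is awake: continue with a new local
state, sleeping during the next `r` rounds (`r = 0`: it is awake in the next round), or return an
output value and stop for good. -/
inductive Action (State V : Type u) : Type u
  | continue (s : State) (r : ℕ)
  | output (v : V)

/-- A deterministic algorithm for `n` processors with input and output values in `V`, in the
synchronous clique network. Each processor knows its own identifier and its input value. In every
round in which it is awake, it sends to each processor at most one message, which depends on its
local state, receives messages, each labelled by the link on which it arrives, and performs an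
arbitrary local computation. There is no signature infrastructure: messages are elements of a plain
set `Msg`, all of which are available to everybody (also to Byzantine processors) at all times. -/
structure Algorithm (V : Type u) (n : ℕ) where
  State : Type u
  Msg : Type u
  /-- initial local state, from the own identifier and the input -/
  start : Fin n → V → State
  /-- message sent to each processor -/
  send : State → Fin n → Option Msg
  /-- local computation, from the local state and the received messages (indexed by sender) -/
  step : State → (Fin n → Option Msg) → Action State V

/-- The status of a processor at the beginning of a round: running, with the number of further
rounds (this one included) in which it sleeps, or terminated with an output. -/
inductive Status (State V : Type u) : Type u
  | running (s : State) (r : ℕ)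
  | halted (v : V)

variable {V : Type u} {n : ℕ}

/-- The data that determine an execution of `A`: the inputs and all choices of the adversary.
Rounds are numbered from `0`. Processor `p` is under the control of the adversary from round
`corruptAt p` on (never, if this is `⊤`); `byz t q p` is the message, if any, that `q` sends to `p`
in round `t` if `q` is then under the control of the adversary. As these are arbitrary functions,
the adversary is adaptive and may know everything, including the messages of the current round. -/
structure Execution (A : Algorithm V n) where
  input : Fin n → V
  corruptAt : Fin n → ℕ∞
  byz : ℕ → Fin n → Fin n → Option A.Msg

/-- The messages sent by a processor that follows the algorithm: none while asleep or halted. -/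
def Algorithm.honestSend (A : Algorithm V n) : Status A.State V → Fin n → Option A.Msg
  | .running s 0, p => A.send s p
  | .running _ (_ + 1), _ => none
  | .halted _, _ => none

/-- The status in the next round of a processor that follows the algorithm, given the messages
addressed to it in this round (they are lost if it is asleep or halted). -/
def Algorithm.next (A : Algorithm V n) :
    Status A.State V → (Fin n → Option A.Msg) → Status A.State V
  | .running s 0, inbox =>
      match A.step s inbox with
      | .continue s' r => .running s' r
      | .output v => .halted v
  | .running s (r + 1), _ => .running s r
  | .halted v, _ => .halted v

namespace Execution

variable {A : Algorithm V n}

/-- The status of `p` at the beginning of round `t`. All processors are awake in round `0`. The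
value is meaningful only as long as `p` has not been corrupted before round `t`. -/
def status (e : Execution A) : ℕ → Fin n → Status A.State V
  | 0, p => .running (A.start p (e.input p)) 0
  | t + 1, p => A.next (e.status t p) fun q =>
      if e.corruptAt q ≤ t then e.byz t q p else A.honestSend (e.status t q) p

/-- `p` is never corrupted. -/
def Honest (e : Execution A) (p : Fin n) : Prop := e.corruptAt p = ⊤

/-- At most `f` processors are ever corrupted. -/
def AtMostFaulty (e : Execution A) (f : ℕ) : Prop := {p | ¬ e.Honest p}.ncard ≤ f

/-- `p` returns `v` after finitely many rounds. -/
def Outputs (e : Execution A) (p : Fin n) (v : V) : Prop := ∃ t, e.status t p = .halted v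

/-- The rounds in which `p`, not yet corrupted, has not yet terminated (it is awake or asleep). -/
def activeRounds (e : Execution A) (p : Fin n) : Set ℕ :=
  {t | (t : ℕ∞) < e.corruptAt p ∧ ∃ s r, e.status t p = .running s r}

/-- The rounds in which `p`, not yet corrupted, is awake. -/
def awakeRounds (e : Execution A) (p : Fin n) : Set ℕ :=
  {t | (t : ℕ∞) < e.corruptAt p ∧ ∃ s, e.status t p = .running s 0}

end Execution

/-- `A` solves Byzantine agreement with up to `f` Byzantine processors. -/
structure Algorithm.SolvesByzantineAgreement (A : Algorithm V n) (f : ℕ) : Prop where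
  safety : ∀ e : Execution A, e.AtMostFaulty f →
    ∀ p v, e.Honest p → e.Outputs p v → ∀ q, e.Honest q → e.Outputs q v
  validity : ∀ e : Execution A, e.AtMostFaulty f →
    ∀ v, (∀ p, e.Honest p → e.input p = v) → ∀ p, e.Honest p → e.Outputs p v
  termination : ∀ e : Execution A, e.AtMostFaulty f → ∀ p, e.Honest p → ∃ v, e.Outputs p v

/-- The maximal number of rounds until a processor terminates, over all processors and all
executions with at most `f` Byzantine processors. -/
noncomputable def Algorithm.roundComplexity (A : Algorithm V n) (f : ℕ) : ℕ∞ :=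
  ⨆ (e : Execution A) (_ : e.AtMostFaulty f) (p : Fin n), (e.activeRounds p).encard

/-- The maximal number of rounds that a single processor spends awake, over all processors and all
executions with at most `f` Byzantine processors. -/
noncomputable def Algorithm.awakeComplexity (A : Algorithm V n) (f : ℕ) : ℕ∞ :=
  ⨆ (e : Execution A) (_ : e.AtMostFaulty f) (p : Fin n), (e.awakeRounds p).encard

end SleepingModel

/-!
Let `s` processors, fewer than a third of them faulty, form a committee `S`. They agree by the
recursive version of the phase king algorithm. In each of two phases they first run graded consensus,
which gives every honest member a value and possibly certainty: if all honest members start with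
`x`, all become certain of `x`, and if one is certain of `x`, all have the value `x`
(`Protocol.gradedConsensus_achieves`). Then one half `T` of `S` runs the algorithm recursively on
these values and announces the result, which replaces the values of the uncertain members. If fewer
than a third of `T` are faulty, all honest members of `S` agree after the phase: if somebody is
certain of `x`, then the honest members of `T` all have the input `x`, hence by validity the result
`x` (`Protocol.phase_achieves`). Agreement persists through later phases, whatever `T` does, as
everybody is certain in them. At least one of the two halves of `S` has fewer than a third faulty
members, so two phases, one for each half, suffice (`Protocol.agreement_achieves`).

While one half runs the recursive call, the other half sleeps. Hence the number of rounds satisfies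
`R(s) = 2 R(s / 2) + 6`, but the number of rounds awake only `A(s) = A(s / 2) + 6`
(`Protocol.agreement_takes`). A committee of `3 f + 1` processors therefore agrees in `O(f)` rounds
with `O(log f)` of them awake, and one further round, in which the committee announces its result
to all processors, settles the case of general `n` (`Protocol.fullAgreement_achieves`).

All programs have a schedule that is fixed in advance. They are written as trees `Protocol`, composed
sequentially, and their joint correctness is a statement `Protocol.Achieves` in the style of Hoare
logic. It does not mention when a processor is corrupted: the analysis allows processors
outside the set `H` of honest ones to send anything from the start.
-/

namespace SleepingModel

/-! ### Local programs -/

/-- The program of a single processor, with broadcast messages in `V` and result in `α`: it ends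
with a result, sleeps for one round, or spends one round awake, in which it sends the same message
(or, for `none`, no message) to every processor and continues depending on what it receives. -/
inductive Protocol (V : Type u) (n : ℕ) (α : Type u) : Type u
  | done (a : α)
  | nap (k : Protocol V n α)
  | exchange (m : Option V) (k : (Fin n → Option V) → Protocol V n α)

namespace Protocol

variable {V : Type u} {n : ℕ} {α β γ : Type u}

/-- Sequential composition. -/
def bind : Protocol V n α → (α → Protocol V n β) → Protocol V n β
  | done a, f => f a
  | nap k, f => nap (k.bind f)
  | exchange m k, f => exchange m fun i => (k i).bind f

theorem bind_assoc (c : Protocol V n α) (f : α → Protocol V n β) (g : β → Protocol V n γ) :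
    (c.bind f).bind g = c.bind fun a => (f a).bind g := by
  induction c with
  | done a => rfl
  | nap k ih => simp [bind, ih]
  | exchange m k ih => simp [bind, ih]

/-- The program that remains after one round with received messages `i`. -/
def tick : Protocol V n α → (Fin n → Option V) → Protocol V n α
  | done a, _ => done a
  | nap k, _ => k
  | exchange _ k, i => k i

/-- The message broadcast in the current round. -/
def message : Protocol V n α → Option V
  | done _ => none
  | nap _ => none
  | exchange m _ => m

/-- The processor is awake in the current round. -/
def IsAwake (c : Protocol V n α) : Prop := ∃ m k, c = exchange m k

/-- `c.Takes d a`: whatever messages are received, `c` ends after exactly `d` rounds, in exactly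
`a` of which the processor is awake. -/
inductive Takes : Protocol V n α → ℕ → ℕ → Prop
  | done (x : α) : Takes (done x) 0 0
  | nap {k : Protocol V n α} {d a : ℕ} : Takes k d a → Takes (nap k) (d + 1) a
  | exchange {m : Option V} {k : (Fin n → Option V) → Protocol V n α} {d a : ℕ} :
      (∀ i, Takes (k i) d a) → Takes (exchange m k) (d + 1) (a + 1)

theorem Takes.bind {c : Protocol V n α} {f : α → Protocol V n β} {d a d' a' : ℕ}
    (hc : c.Takes d a) (hf : ∀ x, (f x).Takes d' a') : (c.bind f).Takes (d + d') (a + a') := by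
  induction hc with
  | done x => simpa [Protocol.bind] using hf x
  | nap _ ih => rw [Nat.add_right_comm]; exact .nap ih
  | exchange _ ih => rw [Nat.add_right_comm, Nat.add_right_comm _ 1]; exact .exchange ih

/-- Along every run, a program keeps to the bounds given by `Takes`. -/
theorem Takes.run {c : Protocol V n α} {d a : ℕ} (hc : c.Takes d a) (x : ℕ → Protocol V n α)
    (h0 : x 0 = c) (hx : ∀ t, ∃ i, x (t + 1) = (x t).tick i) :
    {t | (x t).IsAwake}.encard ≤ a ∧ ∀ t, d ≤ t → ∃ v, x t = .done v := by
  -- One step of the induction removes the first round of the run.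
  have shift (x : ℕ → Protocol V n α) (s : Set ℕ) (hs : ∀ t, (x (t + 1)).IsAwake → t ∈ s) :
      {t | (x t).IsAwake} ⊆ {t | t = 0 ∧ (x 0).IsAwake} ∪ Nat.succ '' s := by
    rintro (_ | t) ht
    · exact .inl ⟨rfl, ht⟩
    · exact .inr ⟨t, hs t ht, rfl⟩
  induction hc generalizing x with
  | done v =>
    have h (t : ℕ) : x t = .done v := by
      induction t with
      | zero => exact h0
      | succ t ih => obtain ⟨i, hi⟩ := hx t; rw [hi, ih]; rfl
    refine ⟨?_, fun t _ => ⟨v, h t⟩⟩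
    simp [h, IsAwake]
  | nap _ ih =>
    obtain ⟨i, hi⟩ := hx 0
    obtain ⟨h1, h2⟩ := ih (fun t => x (t + 1)) (by simpa [h0, tick] using hi) fun t => hx (t + 1)
    refine ⟨?_, fun t ht => ?_⟩
    · refine (Set.encard_le_encard (shift x {t | (x (t + 1)).IsAwake} fun t ht => ht)).trans ?_
      refine (Set.encard_union_le _ _).trans ?_
      rw [Nat.succ_injective.encard_image]
      simpa [h0, IsAwake] using h1
    · obtain ⟨t, rfl⟩ := Nat.exists_eq_add_of_le' (Nat.one_le_of_lt ht)
      exact h2 t (by omega)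
  | exchange _ ih =>
    obtain ⟨i, hi⟩ := hx 0
    obtain ⟨h1, h2⟩ := ih i (fun t => x (t + 1)) (by simpa [h0, tick] using hi)
      fun t => hx (t + 1)
    refine ⟨?_, fun t ht => ?_⟩
    · refine (Set.encard_le_encard (shift x {t | (x (t + 1)).IsAwake} fun t ht => ht)).trans ?_
      refine (Set.encard_union_le _ _).trans ?_
      rw [Nat.succ_injective.encard_image, add_comm]
      push_cast
      refine add_le_add h1 ?_
      refine (Set.encard_le_encard (t := {0}) fun t ht => ht.1).trans ?_
      simp
    · obtain ⟨t, rfl⟩ := Nat.exists_eq_add_of_le' (Nat.one_le_of_lt ht)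
      exact h2 t (by omega)

/-! ### Reasoning about programs that run in lockstep -/

/-- `x` is a joint run of all processors in which those in `H` follow the protocol when sending.
The processors outside `H` also have a current program, but send whatever they like. -/
def IsRun (H : Finset (Fin n)) (x : ℕ → Fin n → Protocol V n α) : Prop :=
  ∀ t p, ∃ i : Fin n → Option V, (∀ q ∈ H, i q = (x t q).message) ∧ x (t + 1) p = (x t p).tick i

/-- If all processors `p` start `c p` at the same time, then they all end it after exactly `d`
rounds, with results that satisfy `Q`. Quantifying over the programs `K p` that follow makes the
notion compatible with `Protocol.bind`. -/
def Achieves (H : Finset (Fin n)) (d : ℕ) (c : Fin n → Protocol V n α) (Q : (Fin n → α) → Prop) :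
    Prop :=
  ∀ x : ℕ → Fin n → Protocol V n V, IsRun H x → ∀ (t : ℕ) (K : Fin n → α → Protocol V n V),
    (∀ p, x t p = (c p).bind (K p)) → ∃ b, Q b ∧ ∀ p, x (t + d) p = K p (b p)

variable {H : Finset (Fin n)}

theorem achieves_done {a : Fin n → α} {Q : (Fin n → α) → Prop} (h : Q a) :
    Achieves (V := V) H 0 (fun p => done (a p)) Q :=
  fun _ _ _ _ hK => ⟨a, h, hK⟩

theorem Achieves.mono {d : ℕ} {c : Fin n → Protocol V n α} {Q R : (Fin n → α) → Prop}
    (h : Achieves H d c Q) (hQR : ∀ b, Q b → R b) : Achieves H d c R := fun x hx t K hK =>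
  let ⟨b, hb, hb'⟩ := h x hx t K hK
  ⟨b, hQR b hb, hb'⟩

theorem Achieves.bind {d d' : ℕ} {c : Fin n → Protocol V n α} {f : Fin n → α → Protocol V n β}
    {Q : (Fin n → α) → Prop} {R : (Fin n → β) → Prop} (h : Achieves H d c Q)
    (hf : ∀ b, Q b → Achieves H d' (fun p => f p (b p)) R) :
    Achieves H (d + d') (fun p => (c p).bind (f p)) R := by
  intro x hx t K hK
  obtain ⟨b, hb, hb'⟩ := h x hx t (fun p a => (f p a).bind (K p)) fun p => by
    rw [hK, bind_assoc]
  rw [← add_assoc]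
  exact hf b hb x hx (t + d) K hb'

/-- One round in which exactly the members of `S` are awake; `p` broadcasts `m`. -/
def broadcast (S : Finset (Fin n)) (p : Fin n) (m : Option V) :
    Protocol V n (Fin n → Option V) :=
  if p ∈ S then exchange m done else nap (done fun _ => none)

theorem broadcast_takes (S : Finset (Fin n)) (p : Fin n) (m : Option V) :
    (broadcast S p m).Takes 1 (if p ∈ S then 1 else 0) := by
  unfold broadcast
  split_ifs
  · exact .exchange fun i => .done i
  · exact .nap (.done _)

theorem broadcast_achieves (S : Finset (Fin n)) (m : Fin n → Option V) :
    Achieves H 1 (fun p => broadcast S p (m p))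
      fun b => ∀ p ∈ S, ∀ q ∈ S ∩ H, b p q = m q := by
  intro x hx t K hK
  choose i hi hi' using hx t
  refine ⟨fun p => if p ∈ S then i p else fun _ => none, ?_, fun p => ?_⟩
  · intro p hp q hq
    rw [Finset.mem_inter] at hq
    simp [hp, hi p q hq.2, hK, broadcast, hq.1, Protocol.bind, message]
  · by_cases hp : p ∈ S <;> simp [hi', hK, broadcast, hp, Protocol.bind, tick]

/-! ### Quorums -/

open Classical in
/-- The members of `S` from which `x` was received. -/
noncomputable def supporters (S : Finset (Fin n)) (i : Fin n → Option V) (x : V) :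
    Finset (Fin n) :=
  {q ∈ S | i q = some x}

open Classical in
/-- Some value received from more than `c / 3` of the members of `S`, if there is one. -/
noncomputable def popular (c : ℕ) (S : Finset (Fin n)) (i : Fin n → Option V) : Option V :=
  if h : ∃ x, c * S.card < 3 * (supporters S i x).card then some h.choose else none

theorem lt_of_popular_eq_some {c : ℕ} {S : Finset (Fin n)} {i : Fin n → Option V} {x : V}
    (h : popular c S i = some x) : c * S.card < 3 * (supporters S i x).card := by
  unfold popular at h
  split_ifs at h with hx
  cases h
  exact hx.choose_spec

theorem exists_popular_eq_some {c : ℕ} {S : Finset (Fin n)} {i : Fin n → Option V} {x : V}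
    (h : c * S.card < 3 * (supporters S i x).card) : ∃ y, popular c S i = some y := by
  unfold popular
  rw [dif_pos ⟨x, h⟩]
  exact ⟨_, rfl⟩

/-- Fewer than a third of the members of `S` are outside `H`. -/
def IsSound (H S : Finset (Fin n)) : Prop := 3 * (S \ H).card < S.card

theorem exists_mem_of_popular {c : ℕ} (hc : 0 < c) {S : Finset (Fin n)} {i : Fin n → Option V}
    {x : V} (hS : IsSound H S) (h : popular c S i = some x) : ∃ q ∈ S ∩ H, i q = some x := by
  by_contra! hne
  have hsub : supporters S i x ⊆ S \ H := by
    intro q hq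
    simp only [supporters, Finset.mem_filter] at hq
    refine Finset.mem_sdiff.2 ⟨hq.1, fun hqH => hne q (Finset.mem_inter.2 ⟨hq.1, hqH⟩) hq.2⟩
  have h1 := Finset.card_le_card hsub
  have h2 := lt_of_popular_eq_some h
  have h3 : 1 * S.card ≤ c * S.card := Nat.mul_le_mul_right _ hc
  unfold IsSound at hS
  omega

theorem popular_eq_some_of_forall {c : ℕ} (hc : 0 < c) (hc' : c ≤ 2) {S : Finset (Fin n)}
    {i : Fin n → Option V} {x : V} (hS : IsSound H S) (h : ∀ q ∈ S ∩ H, i q = some x) :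
    popular c S i = some x := by
  have hsub : S ∩ H ⊆ supporters S i x := fun q hq => by
    simp only [supporters, Finset.mem_filter]
    exact ⟨(Finset.mem_inter.1 hq).1, h q hq⟩
  have h1 := Finset.card_le_card hsub
  have h2 := Finset.card_inter_add_card_sdiff S H
  have h3 : c * S.card ≤ 2 * S.card := Nat.mul_le_mul_right _ hc'
  obtain ⟨y, hy⟩ := exists_popular_eq_some (c := c) (S := S) (i := i) (x := x) (by
    unfold IsSound at hS
    omega)
  obtain ⟨q, hq, hqy⟩ := exists_mem_of_popular hc hS hy
  rw [hy, ← hqy, h q hq]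

/-- Two quorums of two thirds intersect in an honest processor, even if the messages of the
others differ between two receivers. -/
theorem popular_two_unique {S : Finset (Fin n)} {i j : Fin n → Option V} {x y : V}
    (hS : IsSound H S) (hij : ∀ q ∈ S ∩ H, i q = j q)
    (hx : popular 2 S i = some x) (hy : popular 2 S j = some y) : x = y := by
  have h1 := lt_of_popular_eq_some hx
  have h2 := lt_of_popular_eq_some hy
  have hsub : supporters S i x ∪ supporters S j y ⊆ S := by
    intro q hq
    simp only [supporters, Finset.mem_union, Finset.mem_filter] at hq
    tauto
  have h3 := Finset.card_le_card hsub
  have h4 := Finset.card_union_add_card_inter (supporters S i x) (supporters S j y)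
  by_contra hxy
  have hsub' : supporters S i x ∩ supporters S j y ⊆ S \ H := by
    intro q hq
    simp only [supporters, Finset.mem_inter, Finset.mem_filter] at hq
    refine Finset.mem_sdiff.2 ⟨hq.1.1, fun hqH => hxy ?_⟩
    have := hij q (Finset.mem_inter.2 ⟨hq.1.1, hqH⟩)
    rw [hq.1.2, hq.2.2] at this
    exact Option.some.inj this
  have h5 := Finset.card_le_card hsub'
  unfold IsSound at hS
  omega

/-- A quorum of two thirds at one receiver leaves more than a third at every other receiver. -/
theorem exists_popular_one {S : Finset (Fin n)} {i j : Fin n → Option V} {x : V}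
    (hS : IsSound H S) (hij : ∀ q ∈ S ∩ H, i q = j q) (hx : popular 2 S i = some x) :
    ∃ y, popular 1 S j = some y := by
  have h1 := lt_of_popular_eq_some hx
  have hsub : supporters S i x ⊆ supporters S j x ∪ (S \ H) := by
    intro q hq
    simp only [supporters, Finset.mem_union, Finset.mem_filter, Finset.mem_sdiff] at hq ⊢
    by_cases hqH : q ∈ H
    · exact .inl ⟨hq.1, (hij q (Finset.mem_inter.2 ⟨hq.1, hqH⟩)).symm.trans hq.2⟩
    · exact .inr ⟨hq.1, hqH⟩
  have h2 := (Finset.card_le_card hsub).trans (Finset.card_union_le _ _)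
  refine exists_popular_eq_some (x := x) ?_
  unfold IsSound at hS
  omega

/-! ### Graded consensus -/

/-- The result of graded consensus for a processor with input `v` that receives `j` in the second
round: a value, and whether it is certain. -/
noncomputable def grade (S : Finset (Fin n)) (v : V) (j : Fin n → Option V) : V × Bool :=
  match popular 2 S j with
  | some x => (x, true)
  | none => ((popular 1 S j).getD v, false)

/-- Graded consensus among the members of `S`: each broadcasts its value, then the value that it
received from more than two thirds of `S`, if any. -/
noncomputable def gradedConsensus (S : Finset (Fin n)) (p : Fin n) (v : V) :
    Protocol V n (V × Bool) :=
  (broadcast S p (some v)).bind fun i =>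
    (broadcast S p (popular 2 S i)).bind fun j => done (grade S v j)

theorem gradedConsensus_takes (S : Finset (Fin n)) (p : Fin n) (v : V) :
    (gradedConsensus S p v).Takes 2 (if p ∈ S then 2 else 0) := by
  have h : (gradedConsensus S p v).Takes _ _ := (broadcast_takes S p (some v)).bind fun i =>
    (broadcast_takes S p (popular 2 S i)).bind fun j => .done (grade S v j)
  convert h using 1
  split_ifs <;> rfl

theorem gradedConsensus_achieves (S : Finset (Fin n)) (a : Fin n → V) :
    Achieves H 2 (fun p => gradedConsensus S p (a p)) fun b => IsSound H S →
      (∀ x, (∀ p ∈ S ∩ H, a p = x) → ∀ p ∈ S ∩ H, b p = (x, true)) ∧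
      ∀ p ∈ S ∩ H, (b p).2 = true → ∀ q ∈ S ∩ H, (b q).1 = (b p).1 := by
  refine (broadcast_achieves S fun p => some (a p)).bind (d' := 1) fun i hi => ?_
  refine (broadcast_achieves S fun p => popular 2 S (i p)).bind (d' := 0) fun j hj => ?_
  refine achieves_done fun hS => ⟨fun x hx p hp => ?_, fun p hp hgp q hq => ?_⟩
  · have hpS := (Finset.mem_inter.1 hp).1
    have h : popular 2 S (j p) = some x := by
      refine popular_eq_some_of_forall two_pos le_rfl hS fun q hq => ?_
      rw [hj p hpS q hq]
      refine popular_eq_some_of_forall two_pos le_rfl hS fun r hr => ?_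
      rw [hi q (Finset.mem_inter.1 hq).1 r hr, hx r hr]
    simp [grade, h]
  · have hpS := (Finset.mem_inter.1 hp).1
    have hqS := (Finset.mem_inter.1 hq).1
    -- All values sent by honest processors in the second round are equal.
    have key {c c' : ℕ} (hc : 0 < c) (hc' : 0 < c') {x y : V} (hx : popular c S (j p) = some x)
        (hy : popular c' S (j q) = some y) : y = x := by
      obtain ⟨r, hr, hrx⟩ := exists_mem_of_popular hc hS hx
      obtain ⟨s, hs, hsy⟩ := exists_mem_of_popular hc' hS hy
      rw [hj p hpS r hr] at hrx
      rw [hj q hqS s hs] at hsy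
      refine popular_two_unique hS (fun z hz => ?_) hsy hrx
      rw [hi s (Finset.mem_inter.1 hs).1 z hz, hi r (Finset.mem_inter.1 hr).1 z hz]
    cases hx : popular 2 S (j p) with
    | none => simp [grade, hx] at hgp
    | some x =>
      cases hy : popular 2 S (j q) with
      | some y => simpa [grade, hx, hy] using key two_pos two_pos hx hy
      | none =>
        obtain ⟨z, hz⟩ := exists_popular_one hS
          (fun r hr => (hj p hpS r hr).trans (hj q hqS r hr).symm) hx
        simpa [grade, hx, hy, hz] using key two_pos one_pos hx hz

/-! ### Agreement in a committee -/

/-- The results `b` are correct for Byzantine agreement among the members of `S` with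
inputs `a`. -/
def IsAgreement (H S : Finset (Fin n)) (a b : Fin n → V) : Prop :=
  (∀ x, (∀ p ∈ S ∩ H, a p = x) → ∀ p ∈ S ∩ H, b p = x) ∧ ∀ p ∈ S ∩ H, ∀ q ∈ S ∩ H, b p = b q

/-- The members of `S` run graded consensus, the members of `T` run `c` on the resulting values
and announce its result, and the members of `S` that are not certain follow the announcement. -/
noncomputable def phase (S T : Finset (Fin n)) (c : Fin n → V → Protocol V n V) (p : Fin n)
    (v : V) : Protocol V n V :=
  (gradedConsensus S p v).bind fun x => (c p x.1).bind fun y =>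
    (broadcast S p (some y)).bind fun i =>
      done (if x.2 = true then x.1 else (popular 2 T i).getD x.1)

theorem phase_takes {S T : Finset (Fin n)} {c : Fin n → V → Protocol V n V} {p : Fin n} {d a : ℕ}
    (hc : ∀ v, (c p v).Takes d a) (v : V) :
    (phase S T c p v).Takes (d + 3) (a + if p ∈ S then 3 else 0) := by
  have h : (phase S T c p v).Takes _ _ := (gradedConsensus_takes S p v).bind fun x =>
    (hc x.1).bind fun y => (broadcast_takes S p (some y)).bind fun i =>
      .done (if x.2 = true then x.1 else (popular 2 T i).getD x.1)
  convert h using 1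
  · omega
  · split_ifs <;> omega

theorem phase_achieves {S T : Finset (Fin n)} {c : Fin n → V → Protocol V n V} {d : ℕ}
    (hTS : T ⊆ S)
    (hc : ∀ a : Fin n → V, Achieves H d (fun p => c p (a p))
      fun b => IsSound H T → IsAgreement H T a b) (a : Fin n → V) :
    Achieves H (d + 3) (fun p => phase S T c p (a p)) fun b => IsSound H S →
      (∀ x, (∀ p ∈ S ∩ H, a p = x) → ∀ p ∈ S ∩ H, b p = x) ∧
      (IsSound H T → ∀ p ∈ S ∩ H, ∀ q ∈ S ∩ H, b p = b q) := by
  rw [show d + 3 = 2 + (d + (1 + 0)) by omega]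
  refine (gradedConsensus_achieves S a).bind fun x hx => ?_
  refine (hc fun p => (x p).1).bind fun y hy => ?_
  refine (broadcast_achieves S fun p => some (y p)).bind fun i hi => ?_
  refine achieves_done fun hS => ⟨fun v hv p hp => ?_, fun hT => ?_⟩
  · simp [(hx hS).1 v hv p hp]
  · have hsub {q : Fin n} (hq : q ∈ T ∩ H) : q ∈ S ∩ H :=
      Finset.inter_subset_inter_right hTS hq
    obtain ⟨hval, hagr⟩ := hy hT
    have hne : (T ∩ H).Nonempty := by
      rw [← Finset.card_pos]
      have := Finset.card_inter_add_card_sdiff T H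
      unfold IsSound at hT
      omega
    obtain ⟨r, hr⟩ := hne
    have hpop (p : Fin n) (hp : p ∈ S ∩ H) : popular 2 T (i p) = some (y r) :=
      popular_eq_some_of_forall two_pos le_rfl hT fun q hq => by
        rw [hi p (Finset.mem_inter.1 hp).1 q (hsub hq), hagr q hq r hr]
    suffices h : ∀ p ∈ S ∩ H,
        (if (x p).2 = true then (x p).1 else (popular 2 T (i p)).getD (x p).1) = y r by
      intro p hp q hq
      rw [h p hp, h q hq]
    intro p hp
    split_ifs with hg
    -- A certain value is the input of all honest members of `T`, hence also their result.
    · exact (hval _ (fun q hq => (hx hS).2 p hp hg q (hsub hq)) r hr).symm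
    · simp [hpop p hp]

/-- One half of `S`, rounded down. -/
noncomputable def half (S : Finset (Fin n)) : Finset (Fin n) :=
  (Finset.exists_subset_card_eq (Nat.div_le_self S.card 2)).choose

theorem half_subset (S : Finset (Fin n)) : half S ⊆ S :=
  (Finset.exists_subset_card_eq (Nat.div_le_self S.card 2)).choose_spec.1

theorem card_half (S : Finset (Fin n)) : (half S).card = S.card / 2 :=
  (Finset.exists_subset_card_eq (Nat.div_le_self S.card 2)).choose_spec.2

/-- Byzantine agreement among the members of `S`, which number at most `2 ^ k`, with the two
halves of `S` taking the role of the king in two successive phases. -/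
noncomputable def agreement : ℕ → Finset (Fin n) → Fin n → V → Protocol V n V
  | 0, _, _, v => done v
  | k + 1, S, p, v =>
      (phase S (half S) (agreement k (half S)) p v).bind
        (phase S (S \ half S) (agreement k (S \ half S)) p)

/-- The number of rounds of `agreement k`. -/
def agreementRounds : ℕ → ℕ
  | 0 => 0
  | k + 1 => (agreementRounds k + 3) + (agreementRounds k + 3)

theorem agreementRounds_add_six (k : ℕ) : agreementRounds k + 6 = 6 * 2 ^ k := by
  induction k with
  | zero => rfl
  | succ k ih => rw [agreementRounds, pow_succ]; omega

/-- A member of `S` is a member of one half only, and so takes part in one recursive call only. -/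
theorem agreement_takes (k : ℕ) (S : Finset (Fin n)) (p : Fin n) (v : V) :
    (agreement k S p v).Takes (agreementRounds k) (if p ∈ S then 6 * k else 0) := by
  induction k generalizing S v with
  | zero => simpa [agreement, agreementRounds] using Takes.done v
  | succ k ih =>
    have h := (phase_takes (S := S) (T := half S) (fun v => ih (half S) v) v).bind
      (phase_takes (S := S) (T := S \ half S) (fun v => ih (S \ half S) v))
    rw [agreement, agreementRounds]
    convert h using 1
    have hsub := @half_subset n S p
    by_cases h1 : p ∈ S <;> by_cases h2 : p ∈ half S <;> simp_all <;> omega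

theorem agreement_achieves (k : ℕ) (S : Finset (Fin n)) (hk : S.card ≤ 2 ^ k) (a : Fin n → V) :
    Achieves H (agreementRounds k) (fun p => agreement k S p (a p))
      fun b => IsSound H S → IsAgreement H S a b := by
  induction k generalizing S a with
  | zero =>
    refine achieves_done fun _ => ⟨fun x hx => hx, fun p hp q hq => ?_⟩
    rw [Finset.card_le_one.1 hk p (Finset.mem_inter.1 hp).1 q (Finset.mem_inter.1 hq).1]
  | succ k ih =>
    have hcard : (S \ half S).card = S.card - S.card / 2 := by
      rw [Finset.card_sdiff_of_subset (half_subset S), card_half]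
    rw [pow_succ] at hk
    have h1 : (half S).card ≤ 2 ^ k := by rw [card_half]; omega
    have h2 : (S \ half S).card ≤ 2 ^ k := by omega
    refine (phase_achieves (half_subset S) (ih _ h1) a).bind fun b hb => ?_
    refine (phase_achieves Finset.sdiff_subset (ih _ h2) b).mono fun c hc hS => ?_
    obtain ⟨hb1, hb2⟩ := hb hS
    obtain ⟨hc1, hc2⟩ := hc hS
    refine ⟨fun x hx => hc1 x (hb1 x hx), fun p hp q hq => ?_⟩
    -- One of the two halves is sound; agreement reached in the first phase persists.
    by_cases hT : IsSound H (half S)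
    · have h := hc1 (b p) fun r hr => hb2 hT r hr p hp
      rw [h p hp, h q hq]
    · refine hc2 ?_ p hp q hq
      have e : (half S \ H).card + ((S \ half S) \ H).card = (S \ H).card := by
        rw [← Finset.card_union_of_disjoint, ← Finset.union_sdiff_distrib,
          Finset.union_sdiff_of_subset (half_subset S)]
        exact Finset.disjoint_sdiff.mono Finset.sdiff_subset Finset.sdiff_subset
      rw [IsSound, card_half] at hT
      unfold IsSound at hS ⊢
      omega

/-! ### The algorithm for all processors -/

/-- The first `3 * f + 1` processors. -/
def committee (n f : ℕ) : Finset (Fin n) := {p | p.val < 3 * f + 1}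

theorem card_committee {n f : ℕ} (h : 3 * f < n) : (committee n f).card = 3 * f + 1 := by
  simp only [committee, Fin.card_filter_val_lt]
  omega

/-- The depth of the recursion in a committee of `3 * f + 1` processors. -/
def depth (f : ℕ) : ℕ := Nat.log 2 (f + 1) + 3

theorem three_mul_add_one_le_two_pow_depth (f : ℕ) : 3 * f + 1 ≤ 2 ^ depth f := by
  have := Nat.lt_pow_succ_log_self one_lt_two (f + 1)
  rw [depth, show Nat.log 2 (f + 1) + 3 = (Nat.log 2 (f + 1)).succ + 2 from rfl, pow_add]
  omega

/-- Byzantine agreement among all processors: the committee agrees on a value and announces it to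
all. In round `0`, in which all processors are awake, nothing is sent. -/
noncomputable def fullAgreement (f : ℕ) (p : Fin n) (v : V) : Protocol V n V :=
  (broadcast Finset.univ p none).bind fun _ =>
    (agreement (depth f) (committee n f) p v).bind fun y =>
      (broadcast Finset.univ p (some y)).bind fun i =>
        done ((popular 2 (committee n f) i).getD v)

theorem fullAgreement_isAwake (f : ℕ) (p : Fin n) (v : V) : (fullAgreement f p v).IsAwake := by
  simp [fullAgreement, broadcast, Protocol.bind, IsAwake]

theorem fullAgreement_takes (f : ℕ) (p : Fin n) (v : V) :
    (fullAgreement f p v).Takes (agreementRounds (depth f) + 2)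
      ((if p ∈ committee n f then 6 * depth f else 0) + 2) := by
  have h : (fullAgreement f p v).Takes _ _ := (broadcast_takes Finset.univ p none).bind fun _ =>
    (agreement_takes (depth f) (committee n f) p v).bind fun y =>
      (broadcast_takes Finset.univ p (some y)).bind fun i =>
        .done ((popular 2 (committee n f) i).getD v)
  convert h using 1
  · omega
  · simp only [Finset.mem_univ, if_true]
    omega

theorem fullAgreement_achieves {f : ℕ} (hf : 3 * f < n) (hH : (Finset.univ \ H).card ≤ f)
    (a : Fin n → V) :
    Achieves H (agreementRounds (depth f) + 2) (fun p => fullAgreement f p (a p))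
      (IsAgreement H Finset.univ a) := by
  have hS : IsSound H (committee n f) := by
    have := Finset.card_le_card
      (Finset.sdiff_subset_sdiff (Finset.subset_univ (committee n f)) (Finset.Subset.refl H))
    rw [IsSound, card_committee hf]
    omega
  have hne : (committee n f ∩ H).Nonempty := by
    rw [← Finset.card_pos]
    have := Finset.card_inter_add_card_sdiff (committee n f) H
    unfold IsSound at hS
    omega
  obtain ⟨r, hr⟩ := hne
  have hsub {q : Fin n} (hq : q ∈ committee n f ∩ H) : q ∈ Finset.univ ∩ H :=
    Finset.inter_subset_inter_right (Finset.subset_univ _) hq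
  rw [show agreementRounds (depth f) + 2 = 1 + (agreementRounds (depth f) + (1 + 0)) by omega]
  refine (broadcast_achieves Finset.univ fun _ => none).bind fun _ _ => ?_
  refine (agreement_achieves (depth f) (committee n f)
    ((card_committee hf).trans_le (three_mul_add_one_le_two_pow_depth f)) a).bind fun y hy => ?_
  refine (broadcast_achieves Finset.univ fun p => some (y p)).bind fun i hi => ?_
  obtain ⟨hval, hagr⟩ := hy hS
  have hpop (p : Fin n) : popular 2 (committee n f) (i p) = some (y r) :=
    popular_eq_some_of_forall two_pos le_rfl hS fun q hq => by
      rw [hi p (Finset.mem_univ p) q (hsub hq), hagr q hq r hr]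
  refine achieves_done ⟨fun x hx p _ => ?_, fun p _ q _ => ?_⟩
  · simpa [hpop] using hval x (fun q hq => hx q (hsub hq)) r hr
  · simp [hpop]

/-! ### From local programs to the sleeping model -/

/-- The action that leads to the program `c`: naps are merged into a single period of sleep. A
processor that only has to sleep before it ends returns its result at once. -/
def toAction : Protocol V n V → Action (Protocol V n V) V
  | done v => .output v
  | nap k =>
      match toAction k with
      | .continue s r => .continue s (r + 1)
      | .output v => .output v
  | exchange m k => .continue (exchange m k) 0

/-- The algorithm in which processor `p` with input `v` runs `c p v`. -/
def toAlgorithm (c : Fin n → V → Protocol V n V) : Algorithm V n where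
  State := Protocol V n V
  Msg := V
  start := c
  send s _ := s.message
  step s i := (s.tick i).toAction

/-- A status of a processor represents its current program. A halted processor may have naps left
in its program, since it returns its result before them. A running one always wakes up in a round in
which it takes part in an exchange, so that it is not awake in vain. -/
def Represents : Status (Protocol V n V) V → Protocol V n V → Prop
  | .running s r, c => s.IsAwake ∧ c = nap^[r] s
  | .halted v, c => ∃ r, c = nap^[r] (done v)

/-- The status that results from an action. -/
def statusOf : Action (Protocol V n V) V → Status (Protocol V n V) V
  | .continue s r => .running s r
  | .output v => .halted v

theorem represents_toAction (c : Protocol V n V) : Represents (statusOf c.toAction) c := by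
  induction c with
  | done v => exact ⟨0, rfl⟩
  | nap k ih =>
    unfold toAction
    rcases h : k.toAction with ⟨s, r⟩ | ⟨v⟩
    · rw [h] at ih
      refine ⟨ih.1, ?_⟩
      rw [Function.iterate_succ_apply', ← ih.2]
    · rw [h] at ih
      obtain ⟨r, hr⟩ := ih
      exact ⟨r + 1, by rw [Function.iterate_succ_apply', ← hr]⟩
  | exchange m k _ => exact ⟨⟨m, k, rfl⟩, rfl⟩

variable {c : Fin n → V → Protocol V n V}

theorem Represents.honestSend {σ : Status (Protocol V n V) V} {x : Protocol V n V}
    (h : Represents σ x) (p : Fin n) : (toAlgorithm c).honestSend σ p = x.message := by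
  match σ, h with
  | .running s 0, ⟨_, h⟩ => rw [h]; rfl
  | .running s (r + 1), ⟨_, h⟩ => rw [h, Function.iterate_succ_apply']; rfl
  | .halted v, ⟨0, h⟩ => rw [h]; rfl
  | .halted v, ⟨r + 1, h⟩ => rw [h, Function.iterate_succ_apply']; rfl

theorem Represents.next {σ : Status (Protocol V n V) V} {x : Protocol V n V}
    (h : Represents σ x) (i : Fin n → Option V) :
    Represents ((toAlgorithm c).next σ i) (x.tick i) := by
  match σ, h with
  | .running s 0, ⟨_, h⟩ =>
    have e : (toAlgorithm c).next (.running s 0) i = statusOf (s.tick i).toAction := by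
      simp only [Algorithm.next, toAlgorithm]
      cases (s.tick i).toAction <;> rfl
    rw [h]
    exact (congrArg (Represents · _) e).mpr (represents_toAction _)
  | .running s (r + 1), ⟨hs, h⟩ =>
    rw [h, Function.iterate_succ_apply']
    exact ⟨hs, rfl⟩
  | .halted v, ⟨0, h⟩ => rw [h]; exact ⟨0, rfl⟩
  | .halted v, ⟨r + 1, h⟩ =>
    rw [h, Function.iterate_succ_apply']
    exact ⟨r, rfl⟩

theorem Represents.eq_halted {σ : Status (Protocol V n V) V} {v : V}
    (h : Represents σ (done v)) : σ = .halted v := by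
  match σ, h with
  | .running s 0, ⟨⟨m, k, hs⟩, h⟩ => rw [hs] at h; cases h
  | .running s (r + 1), ⟨_, h⟩ => rw [Function.iterate_succ_apply'] at h; cases h
  | .halted w, ⟨0, h⟩ => cases h; rfl
  | .halted w, ⟨r + 1, h⟩ => rw [Function.iterate_succ_apply'] at h; cases h

/-- The messages addressed to `p` in round `t`. -/
noncomputable def inbox (e : Execution (toAlgorithm c)) (t : ℕ) (p q : Fin n) : Option V :=
  open Classical in
  if e.corruptAt q ≤ t then e.byz t q p else (toAlgorithm c).honestSend (e.status t q) p

/-- The program of `p` at the beginning of round `t`. -/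
noncomputable def program (e : Execution (toAlgorithm c)) : ℕ → Fin n → Protocol V n V
  | 0, p => c p (e.input p)
  | t + 1, p => (program e t p).tick (inbox e t p)

theorem status_succ (e : Execution (toAlgorithm c)) (t : ℕ) (p : Fin n) :
    e.status (t + 1) p = (toAlgorithm c).next (e.status t p) (inbox e t p) := by
  rw [Execution.status]
  congr 1

theorem represents_status (hc : ∀ p v, (c p v).IsAwake) (e : Execution (toAlgorithm c)) (t : ℕ)
    (p : Fin n) : Represents (e.status t p) (program e t p) := by
  induction t with
  | zero => exact ⟨hc _ _, rfl⟩
  | succ t ih =>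
    rw [status_succ]
    exact ih.next _

theorem isRun_program (hc : ∀ p v, (c p v).IsAwake) (e : Execution (toAlgorithm c))
    (hH : ∀ p ∈ H, e.Honest p) : IsRun H (program e) := by
  refine fun t p => ⟨inbox e t p, fun q hq => ?_, rfl⟩
  have h : ¬ e.corruptAt q ≤ t := by rw [hH q hq]; simp
  exact (if_neg h).trans ((represents_status hc e t q).honestSend p)

theorem isAwake_program (hc : ∀ p v, (c p v).IsAwake) {e : Execution (toAlgorithm c)} {t : ℕ}
    {p : Fin n} {s : Protocol V n V} (h : e.status t p = .running s 0) :
    (program e t p).IsAwake := by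
  have := represents_status hc e t p
  rw [h] at this
  obtain ⟨hs, h⟩ := this
  rwa [h]

theorem status_eq_halted (hc : ∀ p v, (c p v).IsAwake) {e : Execution (toAlgorithm c)} {t : ℕ}
    {p : Fin n} {v : V} (h : program e t p = done v) : e.status t p = .halted v := by
  have := represents_status hc e t p
  rw [h] at this
  exact this.eq_halted

end Protocol

theorem Execution.status_add_of_halted {V : Type u} {n : ℕ} {A : Algorithm V n} {e : Execution A}
    {t : ℕ} {p : Fin n} {v : V} (h : e.status t p = .halted v) (d : ℕ) :
    e.status (t + d) p = .halted v := by
  induction d with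
  | zero => exact h
  | succ d ih => rw [← add_assoc, Execution.status, ih]; rfl

theorem Execution.Outputs.unique {V : Type u} {n : ℕ} {A : Algorithm V n} {e : Execution A}
    {p : Fin n} {v w : V} (hv : e.Outputs p v) (hw : e.Outputs p w) : v = w := by
  obtain ⟨t, ht⟩ := hv
  obtain ⟨s, hs⟩ := hw
  have h1 := status_add_of_halted ht s
  have h2 := status_add_of_halted hs t
  rw [add_comm, h1] at h2
  cases h2
  rfl

namespace Protocol

variable {V : Type u} {n : ℕ} {f : ℕ}

theorem toAlgorithm_solves {c : Fin n → V → Protocol V n V} {d : ℕ}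
    (hc : ∀ p v, (c p v).IsAwake)
    (h : ∀ H : Finset (Fin n), (Finset.univ \ H).card ≤ f → ∀ a : Fin n → V,
      Achieves H d (fun p => c p (a p)) (IsAgreement H Finset.univ a)) :
    (toAlgorithm c).SolvesByzantineAgreement f := by
  classical
  have key (e : Execution (toAlgorithm c)) (he : e.AtMostFaulty f) :
      ∃ b : Fin n → V, (∀ p, e.Outputs p (b p)) ∧
        (∀ x, (∀ p, e.Honest p → e.input p = x) → ∀ p, e.Honest p → b p = x) ∧
        ∀ p, e.Honest p → ∀ q, e.Honest q → b p = b q := by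
    have hH : (Finset.univ \ ({p | e.Honest p} : Finset (Fin n))).card ≤ f := by
      rw [Execution.AtMostFaulty, Set.ncard_eq_toFinset_card'] at he
      convert he using 2
      ext p
      simp
    obtain ⟨b, hb, hb'⟩ := h _ hH e.input (program e) (isRun_program hc e (by simp)) 0
      (fun _ => done) (fun p => by
        have hid (c : Protocol V n V) : c = c.bind done := by
          induction c with
          | done => rfl
          | nap k ih => rw [Protocol.bind, ← ih]
          | exchange m k ih => simp only [Protocol.bind, ← ih]
        exact hid _)
    refine ⟨b, fun p => ⟨_, status_eq_halted hc (hb' p)⟩, ?_⟩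
    simpa [IsAgreement] using hb
  refine ⟨fun e he p v hp hv q hq => ?_, fun e he v hv p hp => ?_, fun e he p _ => ?_⟩
  · obtain ⟨b, hb, -, hagr⟩ := key e he
    rw [hv.unique (hb p), hagr p hp q hq]
    exact hb q
  · obtain ⟨b, hb, hval, -⟩ := key e he
    rw [← hval v hv p hp]
    exact hb p
  · obtain ⟨b, hb, -⟩ := key e he
    exact ⟨_, hb p⟩

theorem toAlgorithm_complexity {c : Fin n → V → Protocol V n V} {d a : ℕ}
    (hc : ∀ p v, (c p v).IsAwake) (h : ∀ p v, ∃ a' ≤ a, (c p v).Takes d a') :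
    (toAlgorithm c).awakeComplexity f ≤ a ∧ (toAlgorithm c).roundComplexity f ≤ d := by
  have key (e : Execution (toAlgorithm c)) (p : Fin n) :
      {t | (program e t p).IsAwake}.encard ≤ a ∧ ∀ t, d ≤ t → ∃ v, program e t p = .done v := by
    obtain ⟨a', ha', h⟩ := h p (e.input p)
    obtain ⟨h1, h2⟩ := h.run (fun t => program e t p) rfl fun t => ⟨_, rfl⟩
    exact ⟨h1.trans (by exact_mod_cast ha'), h2⟩
  refine ⟨iSup_le fun e => iSup_le fun _ => iSup_le fun p => ?_,
    iSup_le fun e => iSup_le fun _ => iSup_le fun p => ?_⟩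
  · refine (Set.encard_le_encard ?_).trans (key e p).1
    rintro t ⟨-, s, hs⟩
    exact isAwake_program hc hs
  · refine (Set.encard_le_encard (t := Set.Iio d) ?_).trans ?_
    · rintro t ⟨-, s, r, hs⟩
      by_contra ht
      obtain ⟨v, hv⟩ := (key e p).2 t (not_lt.1 ht)
      rw [status_eq_halted hc hv] at hs
      cases hs
    · rw [← Finset.coe_Iio, Set.encard_coe_eq_coe_finsetCard, Nat.card_Iio]

end Protocol

end SleepingModel

open SleepingModel Protocol in
theorem mainTheorem4 :
    ∃ (A : ∀ (V : Type u) (n _f : ℕ), SleepingModel.Algorithm V n) (C : ℕ),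
      ∀ (V : Type u) (n f : ℕ), 3 * f < n →
        (A V n f).SolvesByzantineAgreement f ∧
        (A V n f).awakeComplexity f ≤ ((C * (Nat.log 2 (f + 1) + 1) : ℕ) : ℕ∞) ∧
        (A V n f).roundComplexity f ≤ ((C * (f + 1) : ℕ) : ℕ∞) := by
  refine ⟨fun V n f => toAlgorithm (fullAgreement f), 48, fun V n f hf => ?_⟩
  obtain ⟨h1, h2⟩ := toAlgorithm_complexity (V := V) (n := n) (f := f)
    (c := fullAgreement f) (a := 6 * depth f + 2) (fullAgreement_isAwake f)
    fun p v => ⟨_, by split_ifs <;> omega, fullAgreement_takes f p v⟩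
  refine ⟨toAlgorithm_solves (fullAgreement_isAwake f)
    fun H hH a => fullAgreement_achieves hf hH a, h1.trans ?_, h2.trans ?_⟩
  · rw [Nat.cast_le, depth]
    omega
  · have h3 := agreementRounds_add_six (depth f)
    have h4 := Nat.pow_log_le_self 2 (Nat.succ_ne_zero f)
    rw [depth, pow_add] at h3
    rw [Nat.cast_le, depth]
    simp only [Nat.succ_eq_add_one] at h4
    omega
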